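/- Let $d\ge 1$ be an integer. Let $\operatorname{Rec}_d$ be the group, under composition, of all permutations $f$ of $[0,1)^d$ for which there is a finite partition of $[0,1)^d$ into left half-open rectangles $\prod_{i=1}^d [a_i,b_i)$ (with $0\le a_i<b_i\le 1$) such that $f$ is a translation on each rectangle of the partition. A group $\Gamma$ has Property FM if every $\Gamma$-set that carries a $\Gamma$-invariant mean (a $\Gamma$-invariant finitely additive probability measure defined on all its subsets) has a finite $\Gamma$-orbit. A (discrete) group $\Gamma$ has Kazhdan's Property T if there are a finite subset $S\subseteq\Gamma$ and $\varepsilon>0$ such that every unitary representation $\pi$ of $\Gamma$ on a complex Hilbert space having a vector $v\neq 0$ with $\|\pi(s)v-v\|<\varepsilon\|v\|$ for all $s\in S$ has a nonzero $\Gamma$-invariant vector. Then the group $\operatorname{Rec}_d$ has no infinite subgroup with Property FM. In particular, it has no infinite subgroup with Kazhdan's Property T. -/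

import Mathlib

universe u

/-- The half-open unit cube `[0,1)^d`. -/
def unitCube (d : ℕ) : Set (Fin d → ℝ) :=
  {x | ∀ i, x i ∈ Set.Ico (0 : ℝ) 1}

/-- A (left half-open) `d`-rectangle of the unit cube: a product of nonempty intervals
`[a i, b i)` contained in `[0,1)`. -/
def IsRectangle {d : ℕ} (K : Set (Fin d → ℝ)) : Prop :=
  ∃ a b : Fin d → ℝ, (∀ i, 0 ≤ a i ∧ a i < b i ∧ b i ≤ 1) ∧
    K = {x | ∀ i, x i ∈ Set.Ico (a i) (b i)}

/-- A finite partition of the unit cube into `d`-rectangles. -/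
structure IsRectanglePartition {d : ℕ} (P : Set (Set (Fin d → ℝ))) : Prop where
  finite : P.Finite
  isRectangle : ∀ K ∈ P, IsRectangle K
  pairwiseDisjoint : P.PairwiseDisjoint id
  sUnion_eq : ⋃₀ P = unitCube d

/-- The permutation `f` of the unit cube is a translation on `K`. -/
def IsTranslationOn {d : ℕ} (f : Equiv.Perm (unitCube d)) (K : Set (Fin d → ℝ)) : Prop :=
  ∃ t : Fin d → ℝ, ∀ x : unitCube d, (x : Fin d → ℝ) ∈ K →
    (f x : Fin d → ℝ) = (x : Fin d → ℝ) + t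

/-- `f` is a `d`-rectangle exchange transformation. -/
def IsRectangleExchange {d : ℕ} (f : Equiv.Perm (unitCube d)) : Prop :=
  ∃ P : Set (Set (Fin d → ℝ)), IsRectanglePartition P ∧ ∀ K ∈ P, IsTranslationOn f K

theorem IsRectangle.subset_unitCube {d : ℕ} {K : Set (Fin d → ℝ)} (hK : IsRectangle K) :
    K ⊆ unitCube d := by
  obtain ⟨a, b, h, rfl⟩ := hK
  intro x hx i
  exact ⟨(h i).1.trans (hx i).1, (hx i).2.trans_le (h i).2.2⟩

theorem isRectangle_unitCube (d : ℕ) : IsRectangle (unitCube d) :=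
  ⟨fun _ => 0, fun _ => 1, fun _ => ⟨le_refl _, one_pos, le_refl _⟩, rfl⟩

/-- A nonempty intersection of a rectangle with a translate of a rectangle is a rectangle. -/
theorem IsRectangle.inter_translate {d : ℕ} {K L : Set (Fin d → ℝ)} (hK : IsRectangle K)
    (hL : IsRectangle L) (t : Fin d → ℝ) (hne : {x | x ∈ K ∧ x + t ∈ L}.Nonempty) :
    IsRectangle {x | x ∈ K ∧ x + t ∈ L} := by
  obtain ⟨a, b, h, rfl⟩ := hK
  obtain ⟨a', b', h', rfl⟩ := hL
  obtain ⟨y, hy, hy'⟩ := hne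
  refine ⟨fun i => max (a i) (a' i - t i), fun i => min (b i) (b' i - t i), fun i => ?_, ?_⟩
  · have h1 := hy i
    have h2 := hy' i
    simp only [Pi.add_apply, Set.mem_Ico] at h1 h2
    refine ⟨(h i).1.trans (le_max_left _ _), ?_, (min_le_left _ _).trans (h i).2.2⟩
    exact (max_le h1.1 (by linarith)).trans_lt (lt_min h1.2 (by linarith))
  · ext x
    simp only [Set.mem_ofPred_eq, Pi.add_apply, Set.mem_Ico, max_le_iff, lt_min_iff,
      sub_le_iff_le_add, lt_sub_iff_add_lt]
    exact ⟨fun hx i => ⟨⟨(hx.1 i).1, (hx.2 i).1⟩, (hx.1 i).2, (hx.2 i).2⟩,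
      fun hx => ⟨fun i => ⟨(hx i).1.1, (hx i).2.1⟩, fun i => ⟨(hx i).1.2, (hx i).2.2⟩⟩⟩

/-- A translate of a rectangle is a rectangle as soon as it is contained in the unit cube. -/
theorem IsRectangle.translate {d : ℕ} {K : Set (Fin d → ℝ)} (hK : IsRectangle K)
    (t : Fin d → ℝ) (hsub : ∀ x ∈ K, x + t ∈ unitCube d) :
    IsRectangle {y | y - t ∈ K} := by
  obtain ⟨a, b, h, rfl⟩ := hK
  refine ⟨fun i => a i + t i, fun i => b i + t i, fun i => ⟨?_, ?_, ?_⟩, ?_⟩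
  · exact (hsub a (fun j => ⟨le_refl _, (h j).2.1⟩) i).1
  · linarith [(h i).2.1]
  · by_contra hlt
    push Not at hlt
    have hm : max (a i) (1 - t i) < b i := max_lt (h i).2.1 (by linarith)
    have key := hsub (Function.update a i (max (a i) (1 - t i))) (fun j => by
      by_cases hj : j = i
      · subst hj
        simp only [Function.update_self]
        exact ⟨le_max_left _ _, hm⟩
      · simp only [Function.update_of_ne hj]
        exact ⟨le_refl _, (h j).2.1⟩) i
    simp only [Pi.add_apply, Function.update_self, Set.mem_Ico] at key
    linarith [le_max_right (a i) (1 - t i), key.2]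
  · ext y
    simp only [Set.mem_ofPred_eq, Pi.sub_apply, Set.mem_Ico, le_sub_iff_add_le,
      sub_lt_iff_lt_add]

theorem isRectangleExchange_one (d : ℕ) : IsRectangleExchange (1 : Equiv.Perm (unitCube d)) := by
  refine ⟨{unitCube d}, ⟨Set.finite_singleton _, ?_, Set.pairwiseDisjoint_singleton _ _,
    Set.sUnion_singleton _⟩, ?_⟩
  · rintro K rfl
    exact isRectangle_unitCube d
  · rintro K rfl
    exact ⟨0, fun x _ => by simp⟩

theorem IsRectangleExchange.mul {d : ℕ} {g f : Equiv.Perm (unitCube d)}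
    (hg : IsRectangleExchange g) (hf : IsRectangleExchange f) : IsRectangleExchange (g * f) := by
  obtain ⟨P, hP, htP⟩ := hf
  obtain ⟨Q, hQ, htQ⟩ := hg
  choose! t ht using htP
  choose! s hs using htQ
  let F : Set (Fin d → ℝ) × Set (Fin d → ℝ) → Set (Fin d → ℝ) :=
    fun p => {x | x ∈ p.1 ∧ x + t p.1 ∈ p.2}
  refine ⟨{R | R ∈ F '' (P ×ˢ Q) ∧ R.Nonempty}, ⟨?_, ?_, ?_, ?_⟩, ?_⟩
  · exact ((hP.finite.prod hQ.finite).image F).subset (fun R hR => hR.1)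
  · rintro _ ⟨⟨⟨K, L⟩, ⟨hK, hL⟩, rfl⟩, hne⟩
    exact (hP.isRectangle K hK).inter_translate (hQ.isRectangle L hL) _ hne
  · rintro _ ⟨⟨⟨K, L⟩, ⟨hK, hL⟩, rfl⟩, -⟩ _ ⟨⟨⟨K', L'⟩, ⟨hK', hL'⟩, rfl⟩, -⟩ hne
    refine Set.disjoint_left.2 fun x hx hx' => hne ?_
    have e1 : K = K' := hP.pairwiseDisjoint.elim hK hK'
      (Set.not_disjoint_iff.2 ⟨x, hx.1, hx'.1⟩)
    subst e1
    have e2 : L = L' := hQ.pairwiseDisjoint.elim hL hL'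
      (Set.not_disjoint_iff.2 ⟨_, hx.2, hx'.2⟩)
    subst e2
    rfl
  · ext x
    constructor
    · rintro ⟨_, ⟨⟨⟨K, L⟩, ⟨hK, hL⟩, rfl⟩, -⟩, hx⟩
      exact (hP.isRectangle K hK).subset_unitCube hx.1
    · intro hx
      obtain ⟨K, hK, hxK⟩ : x ∈ ⋃₀ P := hP.sUnion_eq ▸ hx
      obtain ⟨L, hL, hxL⟩ : (f ⟨x, hx⟩ : Fin d → ℝ) ∈ ⋃₀ Q := by
        rw [hQ.sUnion_eq]
        exact (f ⟨x, hx⟩).2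
      have hmem : x ∈ F (K, L) := ⟨hxK, by
        have := ht K hK ⟨x, hx⟩ hxK
        rw [this] at hxL
        exact hxL⟩
      exact ⟨F (K, L), ⟨⟨(K, L), ⟨hK, hL⟩, rfl⟩, ⟨x, hmem⟩⟩, hmem⟩
  · rintro _ ⟨⟨⟨K, L⟩, ⟨hK, hL⟩, rfl⟩, -⟩
    refine ⟨t K + s L, fun x hx => ?_⟩
    have h1 := ht K hK x hx.1
    have h2 := hs L hL (f x) (by rw [h1]; exact hx.2)
    rw [Equiv.Perm.mul_apply, h2, h1, add_assoc]

theorem IsRectangleExchange.inv {d : ℕ} {f : Equiv.Perm (unitCube d)}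
    (hf : IsRectangleExchange f) : IsRectangleExchange f⁻¹ := by
  obtain ⟨P, hP, htP⟩ := hf
  choose! t ht using htP
  let F : Set (Fin d → ℝ) → Set (Fin d → ℝ) := fun K => {y | y - t K ∈ K}
  have hsub : ∀ K ∈ P, K ⊆ unitCube d := fun K hK => (hP.isRectangle K hK).subset_unitCube
  have key : ∀ K ∈ P, ∀ y ∈ F K, ∃ x : unitCube d, (x : Fin d → ℝ) ∈ K ∧
      (x : Fin d → ℝ) = y - t K ∧ (f x : Fin d → ℝ) = y := fun K hK y hy =>
    ⟨⟨y - t K, hsub K hK hy⟩, hy, rfl, by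
      rw [ht K hK ⟨y - t K, hsub K hK hy⟩ hy]
      exact sub_add_cancel _ _⟩
  refine ⟨F '' P, ⟨hP.finite.image F, ?_, ?_, ?_⟩, ?_⟩
  · rintro _ ⟨K, hK, rfl⟩
    refine (hP.isRectangle K hK).translate _ fun x hx => ?_
    have := ht K hK ⟨x, hsub K hK hx⟩ hx
    rw [← this]
    exact (f _).2
  · rintro _ ⟨K, hK, rfl⟩ _ ⟨K', hK', rfl⟩ hne
    refine Set.disjoint_left.2 fun y hy hy' => hne ?_
    obtain ⟨x, hx, -, hxy⟩ := key K hK y hy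
    obtain ⟨x', hx', -, hxy'⟩ := key K' hK' y hy'
    have e : x = x' := f.injective (Subtype.ext (hxy.trans hxy'.symm))
    subst e
    have e1 : K = K' := hP.pairwiseDisjoint.elim hK hK' (Set.not_disjoint_iff.2 ⟨x, hx, hx'⟩)
    rw [e1]
  · ext y
    constructor
    · rintro ⟨_, ⟨K, hK, rfl⟩, hy⟩
      obtain ⟨x, -, -, hxy⟩ := key K hK y hy
      exact hxy ▸ (f x).2
    · intro hy
      obtain ⟨x, hx⟩ := f.surjective ⟨y, hy⟩
      obtain ⟨K, hK, hxK⟩ : (x : Fin d → ℝ) ∈ ⋃₀ P := by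
        rw [hP.sUnion_eq]
        exact x.2
      refine ⟨F K, ⟨K, hK, rfl⟩, ?_⟩
      have h1 := ht K hK x hxK
      rw [hx] at h1
      have h2 : y - t K = x := by
        rw [sub_eq_iff_eq_add]
        exact h1
      change y - t K ∈ K
      rw [h2]
      exact hxK
  · rintro _ ⟨K, hK, rfl⟩
    refine ⟨-t K, fun y hy => ?_⟩
    obtain ⟨x, -, hx, hxy⟩ := key K hK y hy
    have e : f⁻¹ y = x := by
      rw [Equiv.Perm.inv_eq_iff_eq]
      exact Subtype.ext hxy.symm
    rw [e, hx, sub_eq_add_neg]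

/-- The group `Rec_d` of rectangle exchange transformations of `[0,1)^d`. -/
def Rec (d : ℕ) : Subgroup (Equiv.Perm (unitCube d)) where
  carrier := {f | IsRectangleExchange f}
  mul_mem' := fun hg hf => hg.mul hf
  one_mem' := isRectangleExchange_one d
  inv_mem' := fun hf => hf.inv

/-- `m` is a mean on `X`, that is, a finitely additive probability measure defined on all
subsets of `X`, and it is invariant under the action of `G`. -/
structure IsInvariantMean (G : Type*) {X : Type*} [Group G] [MulAction G X]
    (m : Set X → ℝ) : Prop where
  nonneg : ∀ A, 0 ≤ m A
  univ_eq_one : m Set.univ = 1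
  union_eq_add : ∀ A B, Disjoint A B → m (A ∪ B) = m A + m B
  invariant : ∀ (g : G) (A : Set X), m ((fun x => g • x) '' A) = m A

/-- Property FM: every `G`-set with an invariant mean has a finite orbit. -/
def HasPropertyFM (G : Type u) [Group G] : Prop :=
  ∀ (X : Type u) [MulAction G X], (∃ m : Set X → ℝ, IsInvariantMean G m) →
    ∃ x : X, (MulAction.orbit G x).Finite

/-- Kazhdan's Property T of the discrete group `G`: for some finite subset `S` and some `ε > 0`,
every unitary representation of `G` on a complex Hilbert space with an `(S, ε)`-invariant vector
has a nonzero invariant vector. -/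
def HasKazhdanPropertyT (G : Type u) [Group G] : Prop :=
  ∃ (S : Finset G) (ε : ℝ), 0 < ε ∧
    ∀ (H : Type u) [NormedAddCommGroup H] [InnerProductSpace ℂ H] [CompleteSpace H]
      (π : G →* (H ≃ₗᵢ[ℂ] H)),
      (∃ v : H, v ≠ 0 ∧ ∀ s ∈ S, ‖π s v - v‖ < ε * ‖v‖) →
        ∃ w : H, w ≠ 0 ∧ ∀ g : G, π g w = w

/-! Both properties force every Følner `Γ`-set to have a finite orbit, and this alone makes a
subgroup `Γ` of `Rec d` finite. Orbits are taken among ultrafilters on the cube, not points: fixing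
an ultrafilter retains information about a whole set. Along an ultrafilter a rectangle exchange is a
single translation, and translations commute, so orbits of ultrafilters grow polynomially and are
Følner, hence finite. Stabilizers thus have finite index; they are finitely generated because `Γ`
is, and each generator, fixing the ultrafilter, is the identity on one of its members. So every
ultrafilter has a member fixed pointwise by a finite index subgroup, and compactness of the space of
ultrafilters gives one such subgroup acting trivially on the cube. -/

/-! ### Følner actions and invariant means -/

section Folner

open scoped Classical

/-- A `G`-set is Følner if it has nonempty finite subsets that are almost invariant under any
given finite subset of `G`. -/
def IsFolner (G X : Type*) [Group G] [MulAction G X] : Prop :=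
  ∀ (S : Finset G) (ε : ℝ), 0 < ε → ∃ F : Finset X, F.Nonempty ∧
    ∀ s ∈ S, (((F.image (s • ·)) \ F).card : ℝ) ≤ ε * F.card

theorem isFolner_of_exists_fixed {G X : Type*} [Group G] [MulAction G X]
    (h : ∀ S : Finset G, ∃ x : X, ∀ s ∈ S, s • x = x) : IsFolner G X := fun S ε hε => by
  obtain ⟨x, hx⟩ := h S
  refine ⟨{x}, Finset.singleton_nonempty _, fun s hs => ?_⟩
  simp [hx s hs, hε.le]

/-- Every Følner `G`-set has a finite orbit. -/
def HasFolnerFiniteOrbits (G : Type u) [Group G] : Prop :=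
  ∀ (X : Type u) [MulAction G X], IsFolner G X → ∃ x : X, (MulAction.orbit G x).Finite

/-- Applying `g⁻¹` moves `F ∩ gA` injectively into `A`; a point that leaves `F` lies in `g⁻¹F \ F`.
-/
theorem card_inter_smul_image_le {G X : Type*} [Group G] [MulAction G X] (F : Finset X) (g : G)
    (A : Set X) :
    (F.filter (· ∈ (fun x => g • x) '' A)).card ≤
      (F.filter (· ∈ A)).card + ((F.image (g⁻¹ • ·)) \ F).card := by
  refine le_trans ?_ (Finset.card_union_le _ _)
  refine Finset.card_le_card_of_injOn (g⁻¹ • ·) ?_ (MulAction.injective g⁻¹).injOn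
  intro x hx
  simp only [Finset.coe_filter, Set.mem_ofPred_eq, Set.mem_image] at hx
  obtain ⟨hxF, a, ha, rfl⟩ := hx
  simp only [inv_smul_smul, Finset.coe_union, Finset.coe_filter, Set.mem_union,
    Set.mem_ofPred_eq, Finset.mem_coe, Finset.mem_sdiff, Finset.mem_image]
  by_cases h : a ∈ F
  · exact Or.inl ⟨h, ha⟩
  · exact Or.inr ⟨⟨_, hxF, inv_smul_smul _ _⟩, h⟩

theorem IsFolner.exists_isInvariantMean {G X : Type*} [Group G] [MulAction G X]
    (h : IsFolner G X) : ∃ m : Set X → ℝ, IsInvariantMean G m := by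
  have hpos : ∀ n : ℕ, (0 : ℝ) < 1 / ((n : ℝ) + 1) := fun n => Nat.one_div_pos_of_nat
  choose F hne hF using fun p : Finset G × ℕ => h p.1 (1 / ((p.2 : ℝ) + 1)) (hpos p.2)
  -- The mean is the limit along `U` of the proportion of `F p` lying in `A`.
  let U : Ultrafilter (Finset G × ℕ) := Ultrafilter.of Filter.atTop
  have hU : (U : Filter (Finset G × ℕ)) ≤ Filter.atTop := Ultrafilter.of_le _
  let r : Set X → Finset G × ℕ → ℝ := fun A p => ((F p).filter (· ∈ A)).card / (F p).card
  have hcard : ∀ p, (0 : ℝ) < (F p).card := fun p => by exact_mod_cast (hne p).card_pos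
  have hr : ∀ A p, r A p ∈ Set.Icc (0 : ℝ) 1 := fun A p => by
    refine ⟨by positivity, (div_le_one (hcard p)).2 ?_⟩
    exact_mod_cast Finset.card_filter_le _ _
  have hlim : ∀ A, ∃ a ∈ Set.Icc (0 : ℝ) 1, Filter.Tendsto (r A) U (nhds a) := fun A =>
    isCompact_Icc.ultrafilter_le_nhds (U.map (r A))
      (Filter.le_principal_iff.2
        (Filter.Eventually.of_forall (f := (U : Filter (Finset G × ℕ))) (hr A)))
  choose m hm hmt using hlim
  -- One inequality suffices: the reverse one is this applied to `g⁻¹` and `gA`.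
  have hle : ∀ (g : G) (A : Set X), m ((fun x => g • x) '' A) ≤ m A := fun g A => by
    have h0 : Filter.Tendsto (fun p : Finset G × ℕ => r A p + 1 / ((p.2 : ℝ) + 1)) U
        (nhds (m A + 0)) := by
      refine (hmt A).add ?_
      have h1 : Filter.Tendsto (fun p : Finset G × ℕ => p.2) Filter.atTop Filter.atTop := by
        rw [← Filter.prod_atTop_atTop_eq]
        exact Filter.tendsto_snd
      exact (tendsto_one_div_add_atTop_nhds_zero_nat (𝕜 := ℝ)).comp (h1.mono_left hU)
    rw [add_zero] at h0
    refine le_of_tendsto_of_tendsto (hmt _) h0 (hU ?_)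
    filter_upwards [Filter.eventually_ge_atTop (({g⁻¹} : Finset G), 0)] with p hp
    have h2 := hF p g⁻¹ (hp.1 (Finset.mem_singleton_self _))
    have h3 : (((F p).filter (· ∈ (fun x => g • x) '' A)).card : ℝ) ≤
        ((F p).filter (· ∈ A)).card + (((F p).image (g⁻¹ • ·)) \ F p).card := by
      exact_mod_cast card_inter_smul_image_le (F p) g A
    change _ / _ ≤ _ / _ + _
    rw [div_le_iff₀ (hcard p), add_mul, div_mul_cancel₀ _ (hcard p).ne']
    linarith
  refine ⟨m, fun A => (hm A).1, ?_, fun A B hAB => ?_, fun g A => le_antisymm (hle g A) ?_⟩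
  · refine tendsto_nhds_unique (hmt _) (tendsto_const_nhds.congr fun p => ?_)
    simp [r, div_self (hcard p).ne']
  · refine tendsto_nhds_unique (hmt _) (((hmt A).add (hmt B)).congr fun p => ?_)
    change _ / _ + _ / _ = _ / _
    rw [← add_div, ← Nat.cast_add, ← Finset.card_union_of_disjoint]
    · congr 3
      ext x
      simp [← and_or_left]
    · exact Finset.disjoint_filter.2 fun x _ hx hx' => Set.disjoint_left.1 hAB hx hx'
  · have := hle g⁻¹ ((fun x => g • x) '' A)
    rwa [Set.image_image, Set.image_congr fun x _ => inv_smul_smul g x, Set.image_id'] at this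

theorem HasPropertyFM.hasFolnerFiniteOrbits {G : Type u} [Group G] (h : HasPropertyFM G) :
    HasFolnerFiniteOrbits G :=
  fun X _ hX => h X hX.exists_isInvariantMean

end Folner

/-! ### Property T via the permutation representation -/

section Koopman

open scoped Classical

/-- The unitary operator on `ℓ²(X)` induced by a permutation of `X`. -/
noncomputable def permLp {X : Type*} (σ : Equiv.Perm X) :
    lp (fun _ : X => ℂ) 2 ≃ₗᵢ[ℂ] lp (fun _ : X => ℂ) 2 where
  toFun f := ⟨fun x => f (σ.symm x), by
    have := (memℓp_gen_iff (by norm_num)).1 (lp.memℓp f)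
    exact (memℓp_gen_iff (by norm_num)).2 ((σ.symm.summable_iff (f := fun x => ‖f x‖ ^ _)).2 this)⟩
  invFun f := ⟨fun x => f (σ x), by
    have := (memℓp_gen_iff (by norm_num)).1 (lp.memℓp f)
    exact (memℓp_gen_iff (by norm_num)).2 ((σ.summable_iff (f := fun x => ‖f x‖ ^ _)).2 this)⟩
  map_add' f g := rfl
  map_smul' c f := rfl
  left_inv f := by ext x; simp
  right_inv f := by ext x; simp
  norm_map' f := by
    rw [lp.norm_eq_tsum_rpow (by norm_num), lp.norm_eq_tsum_rpow (by norm_num)]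
    congr 1
    exact σ.symm.tsum_eq fun x => ‖f x‖ ^ _

@[simp]
theorem permLp_apply {X : Type*} (σ : Equiv.Perm X) (f : lp (fun _ : X => ℂ) 2) (x : X) :
    permLp σ f x = f (σ.symm x) := rfl

/-- The permutation representation of a group on `ℓ²(X)`. -/
noncomputable def koopman (G X : Type*) [Group G] [MulAction G X] :
    G →* (lp (fun _ : X => ℂ) 2 ≃ₗᵢ[ℂ] lp (fun _ : X => ℂ) 2) where
  toFun g := permLp (MulAction.toPerm g)
  map_one' := by ext f x; simp
  map_mul' g h := by ext f x; simp [mul_smul]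

theorem koopman_apply {G X : Type*} [Group G] [MulAction G X] (g : G)
    (f : lp (fun _ : X => ℂ) 2) (x : X) : koopman G X g f x = f (g⁻¹ • x) := rfl

/-- The indicator function of a finite set, as a vector of `ℓ²(X)`. -/
noncomputable def lpIndicator {X : Type*} (F : Finset X) : lp (fun _ : X => ℂ) 2 :=
  ∑ x ∈ F, lp.single 2 x (1 : ℂ)

theorem lpIndicator_apply {X : Type*} (F : Finset X) (x : X) :
    lpIndicator F x = if x ∈ F then 1 else 0 := by
  rw [lpIndicator, lp.coeFn_sum, Finset.sum_apply]
  simp only [lp.single_apply]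
  simp [Pi.single_apply]

theorem norm_lpIndicator_sq {X : Type*} (F : Finset X) : ‖lpIndicator F‖ ^ 2 = F.card := by
  have := lp.norm_sum_single (p := 2) (E := fun _ : X => ℂ) (by norm_num) (fun _ => (1 : ℂ)) F
  simp only [ENNReal.toReal_ofNat, Real.rpow_ofNat] at this
  rw [lpIndicator, this]
  simp

theorem koopman_lpIndicator_sub {G X : Type*} [Group G] [MulAction G X] (g : G) (F : Finset X) :
    koopman G X g (lpIndicator F) - lpIndicator F =
      lpIndicator (F.image (g • ·) \ F) - lpIndicator (F \ F.image (g • ·)) := by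
  ext x
  have hx : x ∈ F.image (g • ·) ↔ g⁻¹ • x ∈ F := by
    simp only [Finset.mem_image]
    exact ⟨fun ⟨y, hy, e⟩ => by rw [← e, inv_smul_smul]; exact hy,
      fun h => ⟨_, h, smul_inv_smul _ _⟩⟩
  simp only [lp.coeFn_sub, Pi.sub_apply, koopman_apply, lpIndicator_apply, Finset.mem_sdiff, hx]
  by_cases h1 : x ∈ F <;> by_cases h2 : g⁻¹ • x ∈ F <;> simp [h1, h2]

theorem norm_koopman_lpIndicator_sub_lt {G X : Type*} [Group G] [MulAction G X] {g : G}
    {F : Finset X} {ε : ℝ} (hε : 0 < ε) (hne : F.Nonempty)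
    (h : (((F.image (g • ·)) \ F).card : ℝ) ≤ ε ^ 2 / 16 * F.card) :
    ‖koopman G X g (lpIndicator F) - lpIndicator F‖ < ε * ‖lpIndicator F‖ := by
  have hpos : 0 < ‖lpIndicator F‖ := by
    have h1 : (0 : ℝ) < F.card := by exact_mod_cast hne.card_pos
    rw [← norm_lpIndicator_sq] at h1
    exact (norm_nonneg _).lt_of_ne' fun e => by simp [e] at h1
  have hc : (F \ F.image (g • ·)).card = (F.image (g • ·) \ F).card :=
    Finset.card_sdiff_comm (Finset.card_image_of_injective _ (MulAction.injective g)).symm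
  -- The constant 16 gives each of the two differences norm at most `ε / 4` times that of the
  -- indicator, so `ε / 2` in total.
  have key : ∀ A : Finset X, (A.card : ℝ) ≤ ε ^ 2 / 16 * F.card →
      ‖lpIndicator A‖ ≤ ε / 4 * ‖lpIndicator F‖ := fun A hA => by
    rw [← norm_lpIndicator_sq, ← norm_lpIndicator_sq] at hA
    refine le_of_sq_le_sq ?_ (by positivity)
    rw [mul_pow, div_pow]
    norm_num
    exact hA
  rw [koopman_lpIndicator_sub]
  have h1 := key _ h
  have h2 := key (F \ F.image (g • ·)) (by rw [hc]; exact h)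
  have h3 := norm_sub_le (lpIndicator (F.image (g • ·) \ F)) (lpIndicator (F \ F.image (g • ·)))
  nlinarith

/-- An invariant vector is constant on orbits, while a square-summable function takes a given
nonzero value only finitely often. -/
theorem exists_finite_orbit_of_koopman_invariant {G X : Type*} [Group G] [MulAction G X]
    {w : lp (fun _ : X => ℂ) 2} (hw : w ≠ 0) (h : ∀ g : G, koopman G X g w = w) :
    ∃ x : X, (MulAction.orbit G x).Finite := by
  obtain ⟨x, hx⟩ : ∃ x, w x ≠ 0 := by
    by_contra! hc
    exact hw (lp.ext (funext hc))
  refine ⟨x, ?_⟩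
  have hs := (memℓp_gen_iff (p := 2) (by norm_num)).1 (lp.memℓp w)
  simp only [ENNReal.toReal_ofNat, Real.rpow_ofNat] at hs
  have hfin := hs.tendsto_cofinite_zero.eventually_lt_const (u := ‖w x‖ ^ 2) (by positivity)
  refine (Filter.eventually_cofinite.1 hfin).subset ?_
  rintro _ ⟨g, rfl⟩
  have e := congrArg (fun f : lp (fun _ : X => ℂ) 2 => f (g • x)) (h g)
  simp only [koopman_apply, inv_smul_smul] at e
  simp [e]

theorem HasKazhdanPropertyT.hasFolnerFiniteOrbits {G : Type u} [Group G]
    (h : HasKazhdanPropertyT G) : HasFolnerFiniteOrbits G := by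
  intro X _ hX
  obtain ⟨S, ε, hε, hT⟩ := h
  obtain ⟨F, hne, hF⟩ := hX S (ε ^ 2 / 16) (by positivity)
  obtain ⟨w, hw, hinv⟩ := hT (lp (fun _ : X => ℂ) 2) (koopman G X) ⟨lpIndicator F, fun h0 => by
    have := norm_lpIndicator_sq F
    rw [h0, norm_zero, zero_pow two_ne_zero] at this
    exact (Nat.cast_pos.2 hne.card_pos).ne this, fun s hs => norm_koopman_lpIndicator_sub_lt hε hne (hF s hs)⟩
  exact exists_finite_orbit_of_koopman_invariant hw hinv

end Koopman

/-! ### Finite generation -/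

section FiniteGeneration

open scoped Classical

/-- In the disjoint union of the `G ⧸ H` over finitely generated `H`, a finite set `S` fixes the
base coset of its own closure. A finite orbit then yields a finitely generated `H` of finite index.
-/
theorem HasFolnerFiniteOrbits.fg {G : Type u} [Group G] (h : HasFolnerFiniteOrbits G) :
    Group.FG G := by
  obtain ⟨⟨H, x⟩, hx⟩ := h (Σ H : {H : Subgroup G // H.FG}, G ⧸ (H : Subgroup G)) (by
    refine isFolner_of_exists_fixed fun S => ?_
    let H : {H : Subgroup G // H.FG} := ⟨Subgroup.closure S, ⟨S, rfl⟩⟩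
    let x : Σ H : {H : Subgroup G // H.FG}, G ⧸ (H : Subgroup G) := ⟨H, ((1 : G) : G ⧸ H.1)⟩
    refine ⟨x, fun s hs => ?_⟩
    change (⟨H, _⟩ : Σ H : {H : Subgroup G // H.FG}, G ⧸ (H : Subgroup G)) = ⟨H, _⟩
    congr 1
    change ((s * 1 : G) : G ⧸ H.1) = ((1 : G) : G ⧸ H.1)
    rw [QuotientGroup.eq, mul_one, mul_one]
    exact inv_mem (Subgroup.subset_closure hs))
  have hfin : Finite (G ⧸ (H : Subgroup G)) := by
    obtain ⟨g, rfl⟩ := QuotientGroup.mk_surjective x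
    refine Set.finite_univ_iff.1 ((hx.preimage (sigma_mk_injective.injOn)).subset fun y _ => ?_)
    obtain ⟨k, rfl⟩ := QuotientGroup.mk_surjective y
    refine ⟨k * g⁻¹, ?_⟩
    change (⟨H, _⟩ : Σ H : {H : Subgroup G // H.FG}, G ⧸ (H : Subgroup G)) = ⟨H, _⟩
    congr 1
    change ((k * g⁻¹ * g : G) : G ⧸ H.1) = _
    rw [inv_mul_cancel_right]
  obtain ⟨S, hS⟩ := H.2
  obtain ⟨T, hT⟩ : ∃ T : Finset G, ∀ y : G ⧸ (H : Subgroup G), ∃ t ∈ T, (t : G ⧸ H.1) = y := by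
    have := Fintype.ofFinite (G ⧸ (H : Subgroup G))
    exact ⟨Finset.univ.image Quotient.out, fun y =>
      ⟨y.out, Finset.mem_image_of_mem _ (Finset.mem_univ _), QuotientGroup.out_eq' y⟩⟩
  refine ⟨⟨S ∪ T, eq_top_iff.2 fun g _ => ?_⟩⟩
  obtain ⟨t, ht, e⟩ := hT g
  have h1 : t⁻¹ * g ∈ (H : Subgroup G) := QuotientGroup.eq.1 e
  rw [← hS] at h1
  have h2 : t ∈ Subgroup.closure ((S ∪ T : Finset G) : Set G) :=
    Subgroup.subset_closure (by simp [ht])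
  have h3 : Subgroup.closure (S : Set G) ≤ Subgroup.closure ((S ∪ T : Finset G) : Set G) :=
    Subgroup.closure_mono (by simp)
  simpa using mul_mem h2 (h3 h1)

end FiniteGeneration

/-! ### Polynomial growth gives Følner sets -/

section Growth

open scoped Classical

theorem exists_succ_le_mul_of_le_pow {a : ℕ → ℝ} (k : ℕ) (h0 : 0 < a 0)
    (h : ∀ n, a n ≤ ((n : ℝ) + 1) ^ k) {δ : ℝ} (hδ : 0 < δ) :
    ∃ n, a (n + 1) ≤ (1 + δ) * a n := by
  by_contra! hc
  have hgeom : ∀ n, (1 + δ) ^ n * a 0 ≤ a n := fun n => by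
    induction n with
    | zero => simp
    | succ n ih =>
      rw [pow_succ', mul_assoc]
      exact (mul_le_mul_of_nonneg_left ih (by positivity)).trans (hc n).le
  have h1 := (tendsto_pow_const_div_const_pow_of_one_lt k (r := 1 + δ) (by linarith)).comp
    (Filter.tendsto_add_atTop_nat 1)
  -- Dividing by `1 + δ` absorbs the index shift, so that `(n + 1) ^ k < (1 + δ) ^ n * a 0`.
  obtain ⟨n, hn⟩ := (h1.eventually_lt_const (u := a 0 / (1 + δ)) (by positivity)).exists
  have hp : 0 < (1 + δ) ^ (n + 1) := by positivity
  simp only [Function.comp_apply, Nat.cast_add, Nat.cast_one] at hn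
  rw [div_lt_div_iff₀ hp (by positivity), pow_succ', mul_comm (a 0), mul_comm _ (1 + δ), mul_assoc]
    at hn
  have := lt_of_mul_lt_mul_left hn (by positivity)
  linarith [hgeom n, h n]

/-- The ball of radius `n` around `x` for the action of the finite set `S`. -/
noncomputable def smulBall {G X : Type*} [Group G] [MulAction G X] (S : Finset G) (x : X) :
    ℕ → Finset X
  | 0 => {x}
  | n + 1 => smulBall S x n ∪ S.biUnion fun s => (smulBall S x n).image (s • ·)

/-- Since the translations commute, a point of the `n`-ball depends only on how often each of
finitely many translations is used. Balls therefore grow polynomially, and some ball barely grows at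
the next step. -/
theorem isFolner_of_translations {G X A Y : Type*} [Group G] [MulAction G X] [Nonempty X]
    [AddCommMonoid A] (j : X → Y) (hj : Function.Injective j) (τ : A → Y → Y)
    (hτ0 : ∀ y, τ 0 y = y) (hτ : ∀ a b y, τ (a + b) y = τ a (τ b y))
    (h : ∀ g : G, ∃ T : Finset A, ∀ x, ∃ t ∈ T, j (g • x) = τ t (j x)) : IsFolner G X := by
  intro S ε hε
  obtain ⟨x⟩ := ‹Nonempty X›
  choose T hT using h
  let R : Finset A := S.biUnion T
  have hball : ∀ n, ∀ y ∈ smulBall S x n, ∃ c : A → ℕ, (∀ a, c a ≤ n) ∧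
      j y = τ (∑ a ∈ R, c a • a) (j x) := fun n => by
    induction n with
    | zero =>
      intro y hy
      rw [smulBall, Finset.mem_singleton] at hy
      exact ⟨fun _ => 0, fun _ => le_rfl, by simp [hy, hτ0]⟩
    | succ n ih =>
      intro y hy
      simp only [smulBall, Finset.mem_union, Finset.mem_biUnion, Finset.mem_image] at hy
      obtain hy | ⟨s, hs, z, hz, rfl⟩ := hy
      · obtain ⟨c, hc, e⟩ := ih y hy
        exact ⟨c, fun a => (hc a).trans n.le_succ, e⟩
      · obtain ⟨c, hc, e⟩ := ih z hz
        obtain ⟨t, ht, e'⟩ := hT s z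
        refine ⟨fun a => c a + if a = t then 1 else 0, fun a => ?_, ?_⟩
        · have := hc a
          dsimp only
          split_ifs <;> omega
        · have htR : t ∈ R := Finset.mem_biUnion.2 ⟨s, hs, ht⟩
          rw [e', e, ← hτ, add_comm t]
          simp [add_smul, Finset.sum_add_distrib, ite_smul, htR]
  have hcard : ∀ n, ((smulBall S x n).card : ℝ) ≤ ((n : ℝ) + 1) ^ R.card := fun n => by
    have h1 : (smulBall S x n).image j ⊆ (Finset.univ : Finset (R → Fin (n + 1))).image
        (fun c => τ (∑ a : R, (c a : ℕ) • (a : A)) (j x)) := by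
      intro z hz
      obtain ⟨y, hy, rfl⟩ := Finset.mem_image.1 hz
      obtain ⟨c, hc, e⟩ := hball n y hy
      refine Finset.mem_image.2 ⟨fun a => ⟨c a, Nat.lt_succ_of_le (hc a)⟩, Finset.mem_univ _, ?_⟩
      rw [e]
      congr 1
      exact Finset.sum_coe_sort R fun a => c a • a
    have h2 := (Finset.card_le_card h1).trans Finset.card_image_le
    rw [Finset.card_image_of_injective _ hj] at h2
    have h3 : (Finset.univ : Finset (R → Fin (n + 1))).card = (n + 1) ^ R.card := by simp
    rw [h3] at h2
    exact_mod_cast h2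
  obtain ⟨n, hn⟩ := exists_succ_le_mul_of_le_pow (a := fun n => ((smulBall S x n).card : ℝ))
    R.card (by simp [smulBall]) hcard hε
  have hmono : ∀ n, (smulBall S x n).Nonempty := fun n => by
    induction n with
    | zero => exact Finset.singleton_nonempty _
    | succ n ih => exact ih.mono Finset.subset_union_left
  refine ⟨smulBall S x n, hmono n, fun s hs => ?_⟩
  have h1 : (smulBall S x n).image (s • ·) \ smulBall S x n ⊆
      smulBall S x (n + 1) \ smulBall S x n :=
    Finset.sdiff_subset_sdiff (fun y hy => Finset.mem_union_right _
      (Finset.mem_biUnion.2 ⟨s, hs, hy⟩)) le_rfl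
  have h2 := Finset.card_le_card h1
  have h3 := Finset.card_sdiff_add_card_eq_card
    (show smulBall S x n ⊆ smulBall S x (n + 1) from Finset.subset_union_left)
  have h4 : ((smulBall S x (n + 1) \ smulBall S x n).card : ℝ) + (smulBall S x n).card =
      (smulBall S x (n + 1)).card := by exact_mod_cast h3
  have h5 : (((smulBall S x n).image (s • ·) \ smulBall S x n).card : ℝ) ≤
      (smulBall S x (n + 1) \ smulBall S x n).card := by exact_mod_cast h2
  linarith

end Growth

/-! ### Compactness argument on ultrafilters -/

section Ultrafilters

/-- The action on ultrafilters induced by an action on points. -/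
@[reducible]
def ultrafilterMulAction (G α : Type*) [Group G] [MulAction G α] :
    MulAction G (Ultrafilter α) where
  smul g U := U.map (g • ·)
  one_smul U := by
    change U.map _ = U
    simp only [one_smul]
    exact U.map_id
  mul_smul g h U := by
    change U.map _ = (U.map _).map _
    simp only [mul_smul]
    rfl

/-- If the stabilizer of every ultrafilter contains a finite index subgroup that fixes pointwise
a member of the ultrafilter, then a finite index subgroup acts trivially. -/
theorem finite_of_forall_ultrafilter {G α : Type*} [Group G] [MulAction G α] [FaithfulSMul G α]
    (h : ∀ U : Ultrafilter α, ∃ K ∈ U, (fixingSubgroup G K).FiniteIndex) : Finite G := by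
  have hbot : (fixingSubgroup G (Set.univ : Set α)) = ⊥ := by
    refine eq_bot_iff.2 fun g hg => ?_
    refine Subgroup.mem_bot.2 (FaithfulSMul.eq_of_smul_eq_smul (α := α) fun x => ?_)
    rw [one_smul]
    exact (mem_fixingSubgroup_iff G).1 hg x trivial
  suffices hfin : (fixingSubgroup G (Set.univ : Set α)).FiniteIndex by
    rw [hbot] at hfin
    exact Subgroup.finite_iff_finite_and_finiteIndex (H := (⊥ : Subgroup G)) |>.2
      ⟨inferInstance, hfin⟩
  by_contra hcon
  -- If no finite index subgroup acts trivially, this filter is proper; an ultrafilter refining it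
  -- contains no set fixed pointwise by a finite index subgroup.
  let 𝓕 : Filter α :=
    { sets := {A | (fixingSubgroup G Aᶜ).FiniteIndex}
      univ_sets := by
        change (fixingSubgroup G (Set.univ : Set α)ᶜ).FiniteIndex
        rw [Set.compl_univ, fixingSubgroup_empty]
        infer_instance
      sets_of_superset := fun {A B} hA hAB => by
        have : (fixingSubgroup G Aᶜ).FiniteIndex := hA
        exact Subgroup.finiteIndex_of_le
          (fixingSubgroup_antitone G α (Set.compl_subset_compl.2 hAB))
      inter_sets := fun {A B} hA hB => by
        have : (fixingSubgroup G Aᶜ).FiniteIndex := hA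
        have : (fixingSubgroup G Bᶜ).FiniteIndex := hB
        change (fixingSubgroup G (A ∩ B)ᶜ).FiniteIndex
        rw [Set.compl_inter, fixingSubgroup_union]
        infer_instance }
  have hne : 𝓕.NeBot := ⟨fun e => hcon (by
    have : (∅ : Set α) ∈ 𝓕 := by rw [e]; trivial
    have h1 : (fixingSubgroup G (∅ : Set α)ᶜ).FiniteIndex := this
    rwa [Set.compl_empty] at h1)⟩
  obtain ⟨K, hK, hKfin⟩ := h (Ultrafilter.of 𝓕)
  have h1 : Kᶜ ∈ 𝓕 := by
    change (fixingSubgroup G Kᶜᶜ).FiniteIndex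
    rwa [compl_compl]
  exact (Ultrafilter.compl_mem_iff_notMem.1 (Ultrafilter.of_le 𝓕 h1)) hK

end Ultrafilters

/-! ### Rectangle exchanges acting on ultrafilters -/

section RectangleExchange

open Filter Topology

/-- An ultrafilter contains some piece of the finite partition. The set `T` does not depend on `U`,
as the growth bound requires. -/
theorem IsRectangleExchange.exists_translations {d : ℕ} {f : Equiv.Perm (unitCube d)}
    (hf : IsRectangleExchange f) : ∃ T : Finset (Fin d → ℝ), ∀ U : Ultrafilter (unitCube d),
      ∃ t ∈ T, ∀ᶠ x in (U : Filter (unitCube d)),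
        (f x : Fin d → ℝ) = (x : Fin d → ℝ) + t := by
  classical
  obtain ⟨P, hP, ht⟩ := hf
  choose! t ht using ht
  refine ⟨hP.finite.toFinset.image t, fun U => ?_⟩
  have hcov : (⋃ K ∈ P, (Subtype.val ⁻¹' K : Set (unitCube d))) ∈ U := by
    refine Filter.mem_of_superset Filter.univ_mem fun x _ => ?_
    obtain ⟨K, hK, hx⟩ : (x : Fin d → ℝ) ∈ ⋃₀ P := by
      rw [hP.sUnion_eq]
      exact x.2
    exact Set.mem_biUnion hK hx
  obtain ⟨K, hK, hKU⟩ := (Ultrafilter.finite_biUnion_mem_iff hP.finite).1 hcov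
  exact ⟨t K, Finset.mem_image_of_mem _ (hP.finite.mem_toFinset.2 hK),
    Filter.mem_of_superset hKU fun x hx => ht K hK x hx⟩

/-- Pushing forward to `Fin d → ℝ`, where addition is defined everywhere, turns the local
translation into a genuine one. -/
theorem map_val_map_perm {d : ℕ} {f : unitCube d → unitCube d} {U : Ultrafilter (unitCube d)}
    {t : Fin d → ℝ} (h : ∀ᶠ x in (U : Filter (unitCube d)),
      (f x : Fin d → ℝ) = (x : Fin d → ℝ) + t) :
    Filter.map Subtype.val (U.map f : Filter (unitCube d)) =
      Filter.map (· + t) (Filter.map Subtype.val (U : Filter (unitCube d))) := by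
  rw [Ultrafilter.coe_map, Filter.map_map, Filter.map_map]
  exact Filter.map_congr h

/-- A rectangle exchange that fixes an ultrafilter is the identity on one of its members. -/
theorem eventually_eq_self_of_map_eq {d : ℕ} {f : unitCube d → unitCube d}
    {U : Ultrafilter (unitCube d)} {t : Fin d → ℝ}
    (h : ∀ᶠ x in (U : Filter (unitCube d)), (f x : Fin d → ℝ) = (x : Fin d → ℝ) + t)
    (hU : U.map f = U) : ∀ᶠ x in (U : Filter (unitCube d)), f x = x := by
  -- `U` converges to some `y` in the closed cube; its image converges both to `y` and to `y + t`,
  -- so `t = 0`.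
  obtain ⟨y, -, hy⟩ := (isCompact_univ_pi fun _ : Fin d => isCompact_Icc (a := (0 : ℝ)) (b := 1)
    ).ultrafilter_le_nhds (U.map Subtype.val) (Filter.le_principal_iff.2
      (Filter.Eventually.of_forall (f := (U : Filter (unitCube d)))
        fun x i _ => ⟨(x.2 i).1, (x.2 i).2.le⟩))
  have h1 : Tendsto (Subtype.val : unitCube d → Fin d → ℝ) U (𝓝 y) := hy
  have h2 : Tendsto (fun x : unitCube d => (f x : Fin d → ℝ)) U (𝓝 y) := by
    refine h1.comp ?_
    change (U.map f : Filter (unitCube d)) ≤ U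
    rw [hU]
  have h3 : Tendsto (fun x : unitCube d => (f x : Fin d → ℝ)) U (𝓝 (y + t)) :=
    (h1.add_const t).congr' (h.mono fun x hx => hx.symm)
  have ht : t = 0 := by simpa using tendsto_nhds_unique h3 h2
  subst ht
  exact h.mono fun x hx => Subtype.ext (by simpa using hx)

theorem finite_of_hasFolnerFiniteOrbits {d : ℕ} {Γ : Subgroup (Rec d)}
    (h : HasFolnerFiniteOrbits Γ) : Finite Γ := by
  let _ := ultrafilterMulAction Γ (unitCube d)
  have hfg := h.fg
  have : FaithfulSMul Γ (unitCube d) := ⟨fun {g k} e =>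
    Subtype.ext (Subtype.ext (Equiv.ext e))⟩
  refine finite_of_forall_ultrafilter (α := unitCube d) fun U => ?_
  have : Nonempty (MulAction.orbit Γ U) := (MulAction.nonempty_orbit U).to_subtype
  have hF : IsFolner Γ (MulAction.orbit Γ U) := by
    refine isFolner_of_translations
      (fun V => Filter.map Subtype.val ((V : Ultrafilter (unitCube d)) : Filter (unitCube d)))
      (fun V W e => Subtype.ext (Ultrafilter.coe_injective
        (Filter.map_injective Subtype.val_injective e)))
      (fun t : Fin d → ℝ => Filter.map (· + t)) (fun 𝓕 => by simp) (fun s t 𝓕 => ?_) fun g => ?_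
    · rw [Filter.map_map]
      congr 1
      ext1 x
      simp [add_comm s, add_assoc]
    · obtain ⟨T, hT⟩ := g.1.2.exists_translations
      refine ⟨T, fun V => ?_⟩
      obtain ⟨t, ht, e⟩ := hT V
      exact ⟨t, ht, map_val_map_perm e⟩
  obtain ⟨V, hV⟩ := h _ hF
  have hU : (MulAction.orbit Γ U).Finite := by
    have h1 := hV.image Subtype.val
    refine h1.subset fun W hW => ?_
    have h2 : (⟨W, hW⟩ : MulAction.orbit Γ U) ∈ MulAction.orbit Γ V :=
      MulAction.exists_smul_eq Γ V ⟨W, hW⟩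
    exact ⟨_, h2, rfl⟩
  have hidx : (MulAction.stabilizer Γ U).FiniteIndex := by
    have : Finite (MulAction.orbit Γ U) := hU
    have := Finite.of_equiv _ (MulAction.orbitEquivQuotientStabilizer Γ U)
    exact Subgroup.finiteIndex_of_finite_quotient
  -- A finite index subgroup of a finitely generated group is finitely generated, so only finitely
  -- many members of `U` need intersecting.
  obtain ⟨S, hS⟩ : (MulAction.stabilizer Γ U).FG :=
    (Group.fg_iff_subgroup_fg _).1 inferInstance
  have hS' : ∀ᶠ x in (U : Filter (unitCube d)), ∀ s ∈ S, s • x = x := by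
    refine (Filter.eventually_all_finset S).2 fun s hs => ?_
    have hs' : s ∈ MulAction.stabilizer Γ U := hS ▸ Subgroup.subset_closure hs
    obtain ⟨T, hT⟩ := s.1.2.exists_translations
    obtain ⟨t, -, e⟩ := hT U
    exact eventually_eq_self_of_map_eq e hs'
  refine ⟨_, hS', ?_⟩
  have hle : MulAction.stabilizer Γ U ≤ fixingSubgroup Γ {x : unitCube d | ∀ s ∈ S, s • x = x} := by
    rw [← hS, Subgroup.closure_le]
    exact fun s hs => (mem_fixingSubgroup_iff Γ).2 fun x hx => hx s hs
  exact Subgroup.finiteIndex_of_le hle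

end RectangleExchange

theorem mainTheorem10 (d : ℕ) (hd : 1 ≤ d) :
    (¬ ∃ Γ : Subgroup (Rec d), Infinite Γ ∧ HasPropertyFM Γ) ∧
      (¬ ∃ Γ : Subgroup (Rec d), Infinite Γ ∧ HasKazhdanPropertyT Γ) := by
  refine ⟨?_, ?_⟩
  · rintro ⟨Γ, hinf, h⟩
    exact not_finite_iff_infinite.2 hinf (finite_of_hasFolnerFiniteOrbits h.hasFolnerFiniteOrbits)
  · rintro ⟨Γ, hinf, h⟩
    exact not_finite_iff_infinite.2 hinf (finite_of_hasFolnerFiniteOrbits h.hasFolnerFiniteOrbits)
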